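/- Let $X$ be a (real or complex) Banach space and let $B_{X^*}$ be the closed unit ball of its dual. Call $X$ *weakly compactly generated* (WCG) if there is a weakly compact set $K\subset X$ whose linear span is norm-dense in $X$. Two convex subsets of topological vector spaces are *affinely homeomorphic* if there is a homeomorphism between them (for the subspace topologies) that preserves convex combinations. Then $(B_{X^*},w^*)$ is affinely homeomorphic to a convex compact subset of $(Y,w)$ for some Banach space $Y$ if and only if $X$ is WCG. Here the scalar field of $Y$, real or complex, may be fixed in advance, independently of that of $X$. -/

import Mathlib

universe u v w

/-- A normed space `X` is weakly compactly generated (WCG) if there is a weakly compact set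
`K ⊆ X` whose linear span is norm-dense in `X`. -/
def IsWCG (𝕜 X : Type*) [RCLike 𝕜] [NormedAddCommGroup X] [NormedSpace 𝕜 X] : Prop :=
  ∃ K : Set X, IsCompact (toWeakSpace 𝕜 X '' K) ∧
    (Submodule.span 𝕜 K).topologicalClosure = ⊤

/-- The closed unit ball of the dual of `X`, as a subset of the dual with its weak* topology. -/
def dualBall (𝕜 X : Type*) [RCLike 𝕜] [NormedAddCommGroup X] [NormedSpace 𝕜 X] :
    Set (WeakDual 𝕜 X) :=
  WeakDual.toStrongDual ⁻¹' Metric.closedBall (0 : StrongDual 𝕜 X) 1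

/-- Two subsets `A`, `B` of real topological vector spaces are affinely homeomorphic if there is a
homeomorphism `A ≃ₜ B` (subspace topologies) that preserves the convex combinations lying in
`A`. (It is used for convex sets, where all convex combinations lie in `A`.) -/
def AffinelyHomeomorphic {E F : Type*} [AddCommGroup E] [Module ℝ E] [TopologicalSpace E]
    [AddCommGroup F] [Module ℝ F] [TopologicalSpace F] (A : Set E) (B : Set F) : Prop :=
  ∃ e : A ≃ₜ B, ∀ (x y z : A) (a b : ℝ), 0 ≤ a → 0 ≤ b → a + b = 1 →
    (z : E) = a • (x : E) + b • (y : E) → (e z : F) = a • (e x : F) + b • (e y : F)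

/-! Taking real parts of functionals reduces everything to real scalars. If `K` is weakly compact
with dense span, restriction `f ↦ f|K` maps the dual ball linearly into `C(K)`: injectively by
density, and continuously for pointwise convergence. By Grothendieck's theorem
(`ContinuousMap.continuous_functional_of_separately_continuous`) boundedness makes this map weakly
continuous: functionals are differences of positive measures, and closure points are sequential
limits, so dominated convergence applies. Conversely, an affine embedding, translated to fix `0`,
extends to an injective linear `T : X* → Y`. Each `g ∘ T` is weak* continuous on the ball, hence is
evaluation at some `S g ∈ X` (`exists_eq_apply_of_continuousOn_dualBall`). Then `S` is weak*-to-weak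
continuous, and the image of the dual ball of `Y` generates `X` because `T` is injective. -/

open Filter Topology MeasureTheory Set

/-! ### Grothendieck's theorem on weak continuity into `C(Q, ℝ)` -/

/-- On a compact space, finitely many continuous real functions are simultaneously approximated
by their values on a finite set. -/
theorem exists_finset_forall_exists_abs_sub_lt {B Q : Type*} [TopologicalSpace Q] [CompactSpace Q]
    {F : B → Q → ℝ} (hF : ∀ b, Continuous (F b)) (S : Finset B) {ε : ℝ} (hε : 0 < ε) :
    ∃ P : Finset Q, ∀ q, ∃ p ∈ P, ∀ b ∈ S, |F b q - F b p| < ε := by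
  obtain ⟨P, hP⟩ := CompactSpace.elim_nhds_subcover
    (fun p : Q => {q | ∀ b ∈ S, |F b q - F b p| < ε}) (fun p => by
      have : ∀ᶠ q in 𝓝 p, ∀ b ∈ S, |F b q - F b p| < ε := by
        rw [eventually_all_finset]
        intro b _
        exact Metric.tendsto_nhds.1 ((hF b).tendsto p) ε hε
      exact this)
  refine ⟨P, fun q => ?_⟩
  have hq : q ∈ ⋃ p ∈ P, {q | ∀ b ∈ S, |F b q - F b p| < ε} := hP ▸ mem_univ q
  simpa using hq

/-- Compact sets of continuous functions on a compact space, with the topology of pointwise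
convergence, have countable tightness in a strong form: points of the closure of `A` are pointwise
limits of sequences in `A`. -/
theorem exists_seq_tendsto_of_mem_closure {B Q : Type*} [TopologicalSpace B] [CompactSpace B]
    [TopologicalSpace Q] [CompactSpace Q] {F : B → Q → ℝ} (hF : ∀ b, Continuous (F b))
    (hF' : ∀ q, Continuous fun b => F b q) {A : Set B} {f : B} (hf : f ∈ closure A) :
    ∃ u : ℕ → B, (∀ n, u n ∈ A) ∧ ∀ q, Tendsto (fun n => F (u n) q) atTop (𝓝 (F f q)) := by
  classical
  have hpos : ∀ n : ℕ, (0 : ℝ) < 1 / (n + 1) := fun n => Nat.one_div_pos_of_nat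
  choose net hnet using fun (S : Finset B) (n : ℕ) =>
    exists_finset_forall_exists_abs_sub_lt hF S (hpos n)
  have happrox : ∀ (P : Finset Q) (n : ℕ), ∃ g ∈ A, ∀ p ∈ P, |F g p - F f p| < 1 / (n + 1) := by
    intro P n
    have : ∀ᶠ g in 𝓝 f, ∀ p ∈ P, |F g p - F f p| < 1 / ((n : ℝ) + 1) := by
      rw [eventually_all_finset]
      intro p _
      exact Metric.tendsto_nhds.1 ((hF' p).tendsto f) _ (hpos n)
    obtain ⟨g, hg, hgA⟩ := mem_closure_iff_nhds.1 hf _ this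
    exact ⟨g, hgA, hg⟩
  choose pick hpickA hpick using happrox
  -- the state is the set of functions found so far, and the union of the nets used so far
  let next : ℕ → Finset B × Finset Q → Finset B × Finset Q := fun n s =>
    (insert (pick (s.2 ∪ net s.1 n) n) s.1, s.2 ∪ net s.1 n)
  let st : ℕ → Finset B × Finset Q := fun n => Nat.rec ({f}, ∅) next n
  have st_succ : ∀ n, st (n + 1) = next n (st n) := fun n => rfl
  let u : ℕ → B := fun n => pick ((st n).2 ∪ net (st n).1 n) n
  have mono1 : Monotone fun n => (st n).1 := monotone_nat_of_le_succ fun n => by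
    simp only [st_succ]; exact Finset.subset_insert _ _
  have mono2 : Monotone fun n => (st n).2 := monotone_nat_of_le_succ fun n => by
    simp only [st_succ]; exact Finset.subset_union_left
  have hf_mem : ∀ n, f ∈ (st n).1 := fun n => mono1 (Nat.zero_le n) (by simp [st])
  have hu_mem : ∀ i n, i < n → u i ∈ (st n).1 := fun i n hin => mono1 (Nat.succ_le_of_lt hin) (by
    simp only [st_succ]; exact Finset.mem_insert_self _ _)
  have hnet_mem : ∀ m n, m ≤ n → net (st m).1 m ⊆ (st n).2 ∪ net (st n).1 n := by
    intro m n hmn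
    rcases hmn.eq_or_lt with rfl | h
    · exact Finset.subset_union_right
    · refine Finset.Subset.trans ?_ Finset.subset_union_left
      refine Finset.Subset.trans ?_ (mono2 (Nat.succ_le_of_lt h))
      simp only [st_succ]; exact Finset.subset_union_right
  refine ⟨u, fun n => hpickA _ _, fun q => ?_⟩
  -- `k n` is a net point that `f` and the earlier `u i` cannot tell from `q` up to `1 / (n + 1)`.
  choose k hk_mem hk using fun n => hnet (st n).1 n q
  have hlim : Tendsto (fun n : ℕ => 1 / ((n : ℝ) + 1)) atTop (𝓝 0) :=
    tendsto_one_div_add_atTop_nhds_zero_nat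
  -- Interchange of limits along `U`, with `u → g` and `k → q'`: `f` and every `u i` agree at `q`
  -- and `q'`, while `g` and `f` agree at every `k m`, hence at `q'`. So `u n q = u n q' → g q' = f
  -- q' = f q`.
  rw [tendsto_iff_ultrafilter]
  intro U hU
  obtain ⟨g, -, hg⟩ := isCompact_univ.ultrafilter_le_nhds (U.map u) (by simp)
  obtain ⟨q', -, hq'⟩ := isCompact_univ.ultrafilter_le_nhds (U.map k) (by simp)
  have hg : Tendsto u U (𝓝 g) := hg
  have hq' : Tendsto k U (𝓝 q') := hq'
  have hval : ∀ b, (∀ᶠ n in atTop, b ∈ (st n).1) → F b q = F b q' := by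
    intro b hb
    have h1 : Tendsto (fun n => F b q - F b (k n)) U (𝓝 0) := by
      refine squeeze_zero_norm' ?_ (hlim.mono_left hU)
      filter_upwards [hU hb] with n hn using (hk n b hn).le
    have h2 : Tendsto (fun n => F b q - F b (k n)) U (𝓝 (F b q - F b q')) :=
      tendsto_const_nhds.sub (((hF b).tendsto q').comp hq')
    exact sub_eq_zero.1 (tendsto_nhds_unique h2 h1)
  have hvf : F f q = F f q' := hval f (.of_forall hf_mem)
  have hvu : ∀ i, F (u i) q = F (u i) q' := fun i =>
    hval (u i) ((eventually_gt_atTop i).mono fun n hn => hu_mem i n hn)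
  have hgk : ∀ m, F g (k m) = F f (k m) := by
    intro m
    have h1 : Tendsto (fun n => F (u n) (k m) - F f (k m)) U (𝓝 0) := by
      refine squeeze_zero_norm' ?_ (hlim.mono_left hU)
      filter_upwards [hU (eventually_ge_atTop m)] with n hn
      exact (hpick _ n (k m) (hnet_mem m n hn (hk_mem m))).le
    have h2 : Tendsto (fun n => F (u n) (k m) - F f (k m)) U (𝓝 (F g (k m) - F f (k m))) :=
      (((hF' (k m)).tendsto g).comp hg).sub tendsto_const_nhds
    exact sub_eq_zero.1 (tendsto_nhds_unique h2 h1)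
  have hgq' : F g q' = F f q' := by
    have h1 : Tendsto (fun m => F g (k m)) U (𝓝 (F g q')) := ((hF g).tendsto q').comp hq'
    have h2 : Tendsto (fun m => F f (k m)) U (𝓝 (F f q')) := ((hF f).tendsto q').comp hq'
    simp only [hgk] at h1
    exact tendsto_nhds_unique h1 h2
  rw [hvf, ← hgq']
  simp only [hvu]
  exact ((hF' q').tendsto g).comp hg

/-- Integrals of a bounded separately continuous function on a product of compact spaces depend
continuously on the parameter. -/
theorem continuous_integral_of_separately_continuous {B Q : Type*} [TopologicalSpace B]
    [CompactSpace B] [TopologicalSpace Q] [CompactSpace Q] [MeasurableSpace Q] [BorelSpace Q]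
    (μ : Measure Q) [IsFiniteMeasure μ] {F : B → Q → ℝ} (hF : ∀ b, Continuous (F b))
    (hF' : ∀ q, Continuous fun b => F b q) {C : ℝ} (hC : ∀ b q, |F b q| ≤ C) :
    Continuous fun b => ∫ q, F b q ∂μ := by
  -- Dominated convergence handles only sequences; these suffice, since every closure point is a
  -- sequential limit.
  refine continuous_iff_isClosed.2 fun s hs => isClosed_of_closure_subset fun f hf => ?_
  obtain ⟨u, huA, hu⟩ := exists_seq_tendsto_of_mem_closure hF hF' hf
  refine hs.mem_of_tendsto (tendsto_integral_of_dominated_convergence (fun _ => C)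
    (fun n => (hF (u n)).aestronglyMeasurable_of_compactSpace) (integrable_const C)
    (fun n => .of_forall fun q => hC (u n) q) (.of_forall hu)) (.of_forall huA)

/-- A positive linear functional on `C(Q, ℝ)`, `Q` compact, is integration against a finite
measure. -/
theorem ContinuousMap.exists_measure_of_nonneg {Q : Type*} [TopologicalSpace Q] [CompactSpace Q]
    [T2Space Q] [MeasurableSpace Q] [BorelSpace Q] (Λ : C(Q, ℝ) →ₗ[ℝ] ℝ)
    (hΛ : ∀ h, 0 ≤ h → 0 ≤ Λ h) :
    ∃ μ : Measure Q, IsFiniteMeasure μ ∧ ∀ h : C(Q, ℝ), Λ h = ∫ q, h q ∂μ := by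
  let L : CompactlySupportedContinuousMap Q ℝ →ₚ[ℝ] ℝ := PositiveLinearMap.mk₀
    { toFun := fun h => Λ (h : C(Q, ℝ))
      map_add' := fun a b => Λ.map_add _ _
      map_smul' := fun c a => Λ.map_smul c _ }
    (fun h hh => hΛ _ fun q => hh q)
  refine ⟨RealRMK.rieszMeasure L, ⟨isCompact_univ.measure_lt_top⟩, fun h => ?_⟩
  exact (RealRMK.integral_rieszMeasure L
    (CompactlySupportedContinuousMap.continuousMapEquiv h)).symm

/-- Subadditivity of `h ↦ ‖h⁺‖`, needed for the sublinear bound in the Hahn–Banach argument below.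
-/
theorem ContinuousMap.norm_sup_zero_add_le {Q : Type*} [TopologicalSpace Q] [CompactSpace Q]
    (h k : C(Q, ℝ)) : ‖(h + k) ⊔ 0‖ ≤ ‖h ⊔ 0‖ + ‖k ⊔ 0‖ := by
  refine (ContinuousMap.norm_le _ (by positivity)).2 fun q => ?_
  have h1 := (h ⊔ 0).norm_coe_le_norm q
  have h2 := (k ⊔ 0).norm_coe_le_norm q
  simp only [ContinuousMap.sup_apply, ContinuousMap.add_apply, ContinuousMap.zero_apply,
    Real.norm_eq_abs, abs_of_nonneg (le_max_right _ (0 : ℝ))] at *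
  refine le_trans (max_le ?_ ?_) (add_le_add h1 h2)
  · exact add_le_add (le_max_left _ _) (le_max_left _ _)
  · exact add_nonneg (le_max_right _ _) (le_max_right _ _)

/-- A continuous linear functional on `C(Q, ℝ)` is the difference of two positive ones. -/
theorem ContinuousMap.exists_nonneg_sub_nonneg {Q : Type*} [TopologicalSpace Q] [CompactSpace Q]
    (φ : C(Q, ℝ) →L[ℝ] ℝ) : ∃ Λ₁ Λ₂ : C(Q, ℝ) →ₗ[ℝ] ℝ, (∀ h, 0 ≤ h → 0 ≤ Λ₁ h) ∧
      (∀ h, 0 ≤ h → 0 ≤ Λ₂ h) ∧ ∀ h, φ h = Λ₁ h - Λ₂ h := by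
  -- Hahn–Banach extends `(h, -h) ↦ φ h` from the antidiagonal, dominated by `N` since `‖h‖ ≤ ‖h⁺‖ +
  -- ‖(-h)⁺‖`. As `N` vanishes on pairs of nonpositive functions, both components of the extension
  -- are positive.
  let N : C(Q, ℝ) × C(Q, ℝ) → ℝ := fun p => ‖φ‖ * (‖p.1 ⊔ 0‖ + ‖p.2 ⊔ 0‖)
  let D : Submodule ℝ (C(Q, ℝ) × C(Q, ℝ)) := LinearMap.ker (LinearMap.coprod .id .id)
  have hD : ∀ p ∈ D, p.2 = -p.1 := fun p hp => by
    have : p.1 + p.2 = 0 := hp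
    exact (neg_eq_of_add_eq_zero_right this).symm
  let f : (C(Q, ℝ) × C(Q, ℝ)) →ₗ.[ℝ] ℝ := ⟨D, (φ.toLinearMap ∘ₗ LinearMap.fst ℝ _ _) ∘ₗ D.subtype⟩
  have hsmul : ∀ (c : ℝ), 0 < c → ∀ h : C(Q, ℝ), ‖(c • h) ⊔ 0‖ = c * ‖h ⊔ 0‖ := by
    intro c hc h
    have : (c • h) ⊔ 0 = c • (h ⊔ 0) := by
      ext q
      simp [mul_max_of_nonneg _ _ hc.le]
    rw [this, norm_smul, Real.norm_of_nonneg hc.le]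
  obtain ⟨g, hg, hgN⟩ := exists_extension_of_le_sublinear f N
    (fun c hc p => by simp only [N, Prod.smul_fst, Prod.smul_snd, hsmul c hc]; ring)
    (fun p r => by
      have h1 := norm_sup_zero_add_le p.1 r.1
      have h2 := norm_sup_zero_add_le p.2 r.2
      simp only [N, Prod.fst_add, Prod.snd_add, ← mul_add]
      exact mul_le_mul_of_nonneg_left (by linarith) φ.opNorm_nonneg)
    (fun ⟨p, hp⟩ => by
      have hp2 := hD p hp
      have h1 : ‖p.1‖ ≤ ‖p.1 ⊔ 0‖ + ‖p.2 ⊔ 0‖ := by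
        rw [hp2]
        refine (ContinuousMap.norm_le _ (by positivity)).2 fun q => ?_
        have h1 := (p.1 ⊔ 0).norm_coe_le_norm q
        have h2 := (-p.1 ⊔ 0).norm_coe_le_norm q
        simp only [ContinuousMap.sup_apply, ContinuousMap.neg_apply, ContinuousMap.zero_apply,
          Real.norm_eq_abs, abs_of_nonneg (le_max_right _ (0 : ℝ))] at *
        have := le_max_left (p.1 q) 0
        have := le_max_right (p.1 q) 0
        have := le_max_left (-p.1 q) 0
        have := le_max_right (-p.1 q) 0
        exact abs_le.2 ⟨by linarith, by linarith⟩
      calc φ p.1 ≤ ‖φ p.1‖ := le_abs_self _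
        _ ≤ ‖φ‖ * ‖p.1‖ := φ.le_opNorm _
        _ ≤ N p := mul_le_mul_of_nonneg_left h1 φ.opNorm_nonneg)
  have hneg : ∀ h : C(Q, ℝ), 0 ≤ h → -h ⊔ 0 = 0 := fun h hh =>
    sup_eq_right.2 (neg_nonpos.2 hh)
  refine ⟨g ∘ₗ LinearMap.inl ℝ _ _, g ∘ₗ LinearMap.inr ℝ _ _, fun h hh => ?_, fun h hh => ?_,
    fun h => ?_⟩
  · have := hgN (-h, 0)
    simp only [N, hneg h hh, sup_idem, norm_zero, add_zero, mul_zero] at this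
    have h2 : g (-h, 0) = -g (h, 0) := by rw [← map_neg]; simp
    simp only [LinearMap.comp_apply, LinearMap.inl_apply]; linarith
  · have := hgN (0, -h)
    simp only [N, hneg h hh, sup_idem, norm_zero, add_zero, mul_zero] at this
    have h2 : g (0, -h) = -g (0, h) := by rw [← map_neg]; simp
    simp only [LinearMap.comp_apply, LinearMap.inr_apply]; linarith
  · have := hg ⟨(h, -h), by simp [f, D]⟩
    have h2 : g (h, -h) = g (h, 0) - g (0, h) := by rw [← map_sub]; simp
    simp only [LinearMap.comp_apply, LinearMap.inl_apply, LinearMap.inr_apply, ← h2]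
    exact this.symm

/-- A bounded separately continuous function `F` on `B × Q`, `B` and `Q` compact, is weakly
continuous as a map from `B` to `C(Q, ℝ)`. -/
theorem ContinuousMap.continuous_functional_of_separately_continuous {B Q : Type*}
    [TopologicalSpace B] [CompactSpace B] [TopologicalSpace Q] [CompactSpace Q] [T2Space Q]
    (φ : C(Q, ℝ) →L[ℝ] ℝ) {F : B → C(Q, ℝ)} (hF : ∀ q, Continuous fun b => F b q)
    {C : ℝ} (hC : ∀ b q, |F b q| ≤ C) : Continuous fun b => φ (F b) := by
  borelize Q
  obtain ⟨Λ₁, Λ₂, h₁, h₂, h⟩ := exists_nonneg_sub_nonneg φ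
  obtain ⟨μ₁, _, hμ₁⟩ := exists_measure_of_nonneg Λ₁ h₁
  obtain ⟨μ₂, _, hμ₂⟩ := exists_measure_of_nonneg Λ₂ h₂
  simp only [h, hμ₁, hμ₂]
  exact (continuous_integral_of_separately_continuous μ₁ (fun b => (F b).continuous) hF hC).sub
    (continuous_integral_of_separately_continuous μ₂ (fun b => (F b).continuous) hF hC)

/-! ### Density of spans by duality -/

section Density

variable {𝕜 X : Type*} [RCLike 𝕜] [NormedAddCommGroup X] [NormedSpace 𝕜 X]

/-- The span of `K` is dense if and only if a functional vanishing on `K` is zero. -/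
theorem Submodule.topologicalClosure_span_eq_top_iff {K : Set X} :
    (Submodule.span 𝕜 K).topologicalClosure = ⊤ ↔
      ∀ f : StrongDual 𝕜 X, (∀ k ∈ K, f k = 0) → f = 0 := by
  constructor
  · intro h f hf
    have hd : Dense (Submodule.span 𝕜 K : Set X) :=
      Submodule.dense_iff_topologicalClosure_eq_top.2 h
    refine ContinuousLinearMap.ext fun x => ?_
    refine congrFun (Continuous.ext_on hd f.continuous continuous_const fun y hy => ?_) x
    have : Submodule.span 𝕜 K ≤ LinearMap.ker f.toLinearMap := Submodule.span_le.2 hf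
    exact this hy
  · intro h
    by_contra hne
    set M := (Submodule.span 𝕜 K).topologicalClosure with hM
    have hMc : IsClosed (M : Set X) := Submodule.isClosed_topologicalClosure _
    obtain ⟨x, hx⟩ : ∃ x, x ∉ M := by
      by_contra! hall
      exact hne (Submodule.eq_top_iff'.2 hall)
    -- Closedness of `M` makes `X ⧸ M` Hausdorff, so some functional is nonzero at the class of `x`;
    -- its pullback kills `K`.
    have : IsClosed (M.toAddSubgroup : Set X) := hMc
    have hx' : (Submodule.Quotient.mk x : X ⧸ M) ≠ 0 := by
      rwa [Ne, Submodule.Quotient.mk_eq_zero]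
    obtain ⟨g, hg⟩ := SeparatingDual.exists_ne_zero (R := 𝕜) hx'
    have := h (g ∘L M.mkQL) fun k hk => by
      have hkM : k ∈ M := Submodule.le_topologicalClosure _ (Submodule.subset_span hk)
      have : (Submodule.Quotient.mk k : X ⧸ M) = 0 := (Submodule.Quotient.mk_eq_zero M).2 hkM
      change g (Submodule.Quotient.mk k) = 0
      rw [this, map_zero]
    exact hg (congrArg (fun f : StrongDual 𝕜 X => f x) this)

end Density

/-! ### Weak topologies and change of scalars -/

section WeakTopology

variable {𝕜 X : Type*} [RCLike 𝕜] [NormedAddCommGroup X] [NormedSpace 𝕜 X]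

theorem WeakSpace.continuous_apply (f : StrongDual 𝕜 X) :
    Continuous fun x : WeakSpace 𝕜 X => f ((toWeakSpace 𝕜 X).symm x) :=
  WeakBilin.eval_continuous _ f

theorem WeakSpace.continuous_of_forall_re {α : Type*} [TopologicalSpace α] {g : α → WeakSpace 𝕜 X}
    (h : ∀ f : StrongDual 𝕜 X, Continuous fun a => RCLike.re (f ((toWeakSpace 𝕜 X).symm (g a)))) :
    Continuous g :=
  WeakBilin.continuous_of_continuous_eval_re _ h

/-- Weakly compact sets are norm bounded. -/
theorem exists_norm_le_of_isCompact_toWeakSpace {K : Set X} (hK : IsCompact (toWeakSpace 𝕜 X '' K)) :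
    ∃ C, ∀ k ∈ K, ‖k‖ ≤ C := by
  -- Uniform boundedness is applied on the dual, which is complete even if `X` is not.
  obtain ⟨C, hC⟩ := banach_steinhaus
    (g := fun k : K => NormedSpace.inclusionInDoubleDual 𝕜 X (k : X)) fun f => by
      obtain ⟨C, hC⟩ := (hK.image (WeakSpace.continuous_apply f)).isBounded.exists_norm_le
      exact ⟨C, fun k => hC _ ⟨_, ⟨k, k.2, rfl⟩, rfl⟩⟩
  refine ⟨C, fun k hk => ?_⟩
  have := hC ⟨k, hk⟩
  rwa [show ‖NormedSpace.inclusionInDoubleDual 𝕜 X k‖ = ‖k‖ from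
    (NormedSpace.inclusionInDoubleDualLi 𝕜).norm_map k] at this

variable [NormedSpace ℝ X] [IsScalarTower ℝ 𝕜 X]

/-- A real functional is the real part of the `𝕜`-linear functional extending it. -/
theorem WeakSpace.continuous_apply_real (f : StrongDual ℝ X) :
    Continuous fun x : WeakSpace 𝕜 X => f ((toWeakSpace 𝕜 X).symm x) := by
  have h := RCLike.continuous_re.comp
    (WeakSpace.continuous_apply (StrongDual.extendRCLike (𝕜 := 𝕜) f))
  simpa [Function.comp_def] using h

variable (𝕜 X) in
/-- The weak topologies of `X` as a space over `𝕜` and over `ℝ` coincide. -/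
noncomputable def WeakSpace.homeomorphReal : WeakSpace 𝕜 X ≃ₜ WeakSpace ℝ X where
  toFun x := toWeakSpace ℝ X ((toWeakSpace 𝕜 X).symm x)
  invFun x := toWeakSpace 𝕜 X ((toWeakSpace ℝ X).symm x)
  left_inv _ := rfl
  right_inv _ := rfl
  continuous_toFun := WeakSpace.continuous_of_forall_re fun f =>
    WeakSpace.continuous_apply_real (𝕜 := 𝕜) f
  continuous_invFun := WeakSpace.continuous_of_forall_re fun f =>
    WeakSpace.continuous_apply (𝕜 := ℝ) (RCLike.reCLM ∘L f.restrictScalars ℝ)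

theorem isCompact_toWeakSpace_image_iff_real {K : Set X} :
    IsCompact (toWeakSpace 𝕜 X '' K) ↔ IsCompact (toWeakSpace ℝ X '' K) := by
  rw [← (WeakSpace.homeomorphReal 𝕜 X).isCompact_image, image_image]
  rfl

/-- The real span of `K ∪ iK` is the `𝕜`-span of `K`; conversely, a `𝕜`-functional is determined by
its real part. -/
theorem isWCG_iff_isWCG_real : IsWCG 𝕜 X ↔ IsWCG ℝ X := by
  constructor
  · rintro ⟨K, hK, hspan⟩
    -- For `𝕜 = ℝ`, `RCLike.I` is `0` and the union adds at most the origin.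
    refine ⟨K ∪ (fun x => (RCLike.I : 𝕜) • x) '' K, ?_, ?_⟩
    · rw [← isCompact_toWeakSpace_image_iff_real (𝕜 := 𝕜), image_union]
      refine hK.union ?_
      have : toWeakSpace 𝕜 X '' ((fun x => (RCLike.I : 𝕜) • x) '' K) =
          (fun x : WeakSpace 𝕜 X => (RCLike.I : 𝕜) • x) '' (toWeakSpace 𝕜 X '' K) := by
        simp only [image_image, map_smul]
      rw [this]
      exact hK.image (continuous_const_smul _)
    · rw [Submodule.topologicalClosure_span_eq_top_iff] at hspan ⊢
      intro f hf
      have h0 := hspan (StrongDual.extendRCLike (𝕜 := 𝕜) f) fun k hk => by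
        rw [StrongDual.extendRCLike_apply, hf k (.inl hk), hf _ (.inr ⟨k, hk, rfl⟩)]
        simp
      ext x
      rw [← StrongDual.re_extendRCLike_apply (𝕜 := 𝕜) f x, h0]
      simp
  · rintro ⟨K, hK, hspan⟩
    refine ⟨K, isCompact_toWeakSpace_image_iff_real.2 hK, ?_⟩
    rw [Submodule.topologicalClosure_span_eq_top_iff] at hspan ⊢
    intro f hf
    have h0 := hspan (StrongDual.extendRCLikeₗ.symm f) fun k hk => by
      change RCLike.re (f k) = 0
      simp [hf k hk]
    exact (LinearEquiv.map_eq_zero_iff _).1 h0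

end WeakTopology

/-! ### Affine homeomorphisms -/

section AffineHomeomorphism

variable {E F G : Type*} [AddCommGroup E] [Module ℝ E] [TopologicalSpace E]
  [AddCommGroup F] [Module ℝ F] [TopologicalSpace F]
  [AddCommGroup G] [Module ℝ G] [TopologicalSpace G]

theorem AffinelyHomeomorphic.trans {A : Set E} {B : Set F} {C : Set G}
    (h : AffinelyHomeomorphic A B) (h' : AffinelyHomeomorphic B C) : AffinelyHomeomorphic A C := by
  obtain ⟨e, he⟩ := h
  obtain ⟨e', he'⟩ := h'
  exact ⟨e.trans e', fun x y z a b ha hb hab hz =>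
    he' _ _ _ a b ha hb hab (he x y z a b ha hb hab hz)⟩

theorem AffinelyHomeomorphic.of_homeomorph (L : E ≃ₜ F)
    (hL : ∀ (a b : ℝ) (x y : E), L (a • x + b • y) = a • L x + b • L y) {A : Set E} {B : Set F}
    (h : ∀ x, x ∈ A ↔ L x ∈ B) : AffinelyHomeomorphic A B :=
  ⟨L.subtype h, fun x y z a b _ _ _ hz => by
    change L (z : E) = a • L (x : E) + b • L (y : E)
    rw [hz, hL]⟩

/-- A linear map which is injective and continuous on a compact set is an affine homeomorphism of
that set onto its image. -/
theorem AffinelyHomeomorphic.image_of_isCompact [T2Space F] (T : E →ₗ[ℝ] F) {A : Set E}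
    (hA : IsCompact A) (hT : ContinuousOn T A) (hinj : InjOn T A) :
    AffinelyHomeomorphic A (T '' A) := by
  have : CompactSpace A := isCompact_iff_compactSpace.1 hA
  let e : A ≃ T '' A := Equiv.Set.imageOfInjOn T A hinj
  have he : Continuous e := (continuousOn_iff_continuous_domRestrict.1 hT).subtype_mk _
  exact ⟨he.homeoOfEquivCompactToT2, fun x y z a b _ _ _ hz => by
    change T (z : E) = a • T (x : E) + b • T (y : E)
    rw [hz, map_add, map_smul, map_smul]⟩

end AffineHomeomorphism

/-! ### Real and `𝕜`-linear dual balls -/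

section DualBall

variable {𝕜 X : Type*} [RCLike 𝕜] [NormedAddCommGroup X] [NormedSpace 𝕜 X]

theorem mem_dualBall {f : WeakDual 𝕜 X} : f ∈ dualBall 𝕜 X ↔ ‖WeakDual.toStrongDual f‖ ≤ 1 := by
  simp [dualBall]

variable (𝕜 X) in
theorem isCompact_dualBall : IsCompact (dualBall 𝕜 X) := WeakDual.isCompact_closedBall _ _

variable [NormedSpace ℝ X] [IsScalarTower ℝ 𝕜 X]

/-- Extending a real functional to a `𝕜`-linear one is isometric, with inverse the real part. -/
theorem extendRCLikeL_mem_dualBall (f : WeakDual ℝ X) :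
    f ∈ dualBall ℝ X ↔ WeakDual.extendRCLikeL (𝕜 := 𝕜) f ∈ dualBall 𝕜 X := by
  have h := StrongDual.norm_extendRCLike (𝕜 := 𝕜) (WeakDual.toStrongDual f)
  rw [mem_dualBall, mem_dualBall, ← h]
  exact Iff.rfl

theorem extendRCLikeL_symm_mem_dualBall (f : WeakDual 𝕜 X) :
    f ∈ dualBall 𝕜 X ↔ WeakDual.extendRCLikeL.symm f ∈ dualBall ℝ X := by
  have h := (StrongDual.extendRCLikeₗᵢ (𝕜 := 𝕜) (F := X)).symm.norm_map (WeakDual.toStrongDual f)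
  rw [mem_dualBall, mem_dualBall, ← h]
  exact Iff.rfl

theorem extendRCLikeL_smul_add_smul (a b : ℝ) (f g : WeakDual ℝ X) :
    WeakDual.extendRCLikeL (𝕜 := 𝕜) (a • f + b • g) =
      a • WeakDual.extendRCLikeL (𝕜 := 𝕜) f + b • WeakDual.extendRCLikeL (𝕜 := 𝕜) g := by
  refine ContinuousLinearMap.ext fun x => ?_
  change ((a * f x + b * g x : ℝ) : 𝕜) -
      (RCLike.I : 𝕜) • ((a * f ((RCLike.I : 𝕜) • x) + b * g ((RCLike.I : 𝕜) • x) : ℝ) : 𝕜) =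
    a • ((f x : 𝕜) - (RCLike.I : 𝕜) • (f ((RCLike.I : 𝕜) • x) : 𝕜)) +
      b • ((g x : 𝕜) - (RCLike.I : 𝕜) • (g ((RCLike.I : 𝕜) • x) : 𝕜))
  simp only [RCLike.real_smul_eq_coe_mul, smul_eq_mul]
  push_cast
  ring

theorem extendRCLikeL_symm_smul_add_smul (a b : ℝ) (f g : WeakDual 𝕜 X) :
    WeakDual.extendRCLikeL.symm (a • f + b • g) =
      a • WeakDual.extendRCLikeL.symm f + b • WeakDual.extendRCLikeL.symm g := by
  refine ContinuousLinearMap.ext fun x => ?_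
  change RCLike.re (a • f x + b • g x) = a * RCLike.re (f x) + b * RCLike.re (g x)
  simp [RCLike.smul_re]

variable (𝕜 X) in
theorem dualBall_affinelyHomeomorphic_real :
    AffinelyHomeomorphic (dualBall 𝕜 X) (dualBall ℝ X) := by
  refine .of_homeomorph (F := WeakDual ℝ X) WeakDual.extendRCLikeL.symm.toHomeomorph ?_ ?_
  · exact fun a b f g => extendRCLikeL_symm_smul_add_smul a b f g
  · exact fun f => extendRCLikeL_symm_mem_dualBall f

variable (𝕜 X) in
theorem affinelyHomeomorphic_dualBall_real :
    AffinelyHomeomorphic (dualBall ℝ X) (dualBall 𝕜 X) := by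
  refine .of_homeomorph (F := WeakDual 𝕜 X) WeakDual.extendRCLikeL.toHomeomorph ?_ ?_
  · exact fun a b f g => extendRCLikeL_smul_add_smul a b f g
  · exact fun f => extendRCLikeL_mem_dualBall f

end DualBall

/-! ### Functionals weak* continuous on the dual ball are evaluations -/

section Evaluation

variable {X : Type*} [NormedAddCommGroup X] [NormedSpace ℝ X]

/-- A linear functional that is weak* continuous on the dual ball is small on the unit vectors of
some subspace of finite codimension which is weak* closed. -/
theorem exists_finset_forall_abs_le {ψ : StrongDual ℝ X →ₗ[ℝ] ℝ}
    (hψ : ContinuousOn (fun f : WeakDual ℝ X => ψ (WeakDual.toStrongDual f)) (dualBall ℝ X))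
    {ε : ℝ} (hε : 0 < ε) :
    ∃ s : Finset X, ∀ f : StrongDual ℝ X, (∀ x ∈ s, f x = 0) → |ψ f| ≤ ε * ‖f‖ := by
  have h0 : (0 : WeakDual ℝ X) ∈ dualBall ℝ X := by simp [mem_dualBall]
  have hnear := Metric.tendsto_nhds.1 (hψ 0 h0) ε hε
  rw [eventually_nhdsWithin_iff] at hnear
  obtain ⟨⟨s, r⟩, hr, hs⟩ := (WeakDual.withSeminorms ℝ X).hasBasis_zero_ball.mem_iff.1 hnear
  refine ⟨s, fun f hf => ?_⟩
  rcases eq_or_ne f 0 with rfl | hne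
  · simp
  have hpos : 0 < ‖f‖ := norm_pos_iff.2 hne
  -- Functionals vanishing on `s` stay in this neighbourhood under any scaling, so `f` may be
  -- normalised.
  have hmem : StrongDual.toWeakDual (‖f‖⁻¹ • f) ∈
      (s.sup (WeakDual.seminormFamily ℝ X)).ball 0 r := by
    rw [Seminorm.mem_ball_zero]
    refine Seminorm.finset_sup_apply_lt hr fun x hx => ?_
    change ‖‖f‖⁻¹ • f x‖ < r
    simpa [hf x hx] using hr
  have hlt := hs hmem (by
    rw [mem_dualBall, StrongDual.toStrongDual_toWeakDual, norm_smul, norm_inv, norm_norm,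
      inv_mul_cancel₀ hpos.ne'])
  simp only [StrongDual.toStrongDual_toWeakDual, map_zero, dist_zero_right, map_smul,
    Real.norm_eq_abs, smul_eq_mul, abs_mul, abs_inv, abs_norm] at hlt
  rw [inv_mul_lt_iff₀ hpos] at hlt
  linarith

/-- A linear functional that is weak* continuous on the dual ball is uniformly approximated by
evaluations. -/
theorem exists_forall_abs_sub_le {ψ : StrongDual ℝ X →ₗ[ℝ] ℝ}
    (hψ : ContinuousOn (fun f : WeakDual ℝ X => ψ (WeakDual.toStrongDual f)) (dualBall ℝ X))
    {ε : ℝ} (hε : 0 < ε) : ∃ x : X, ∀ f : StrongDual ℝ X, |ψ f - f x| ≤ ε * ‖f‖ := by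
  obtain ⟨s, hs⟩ := exists_finset_forall_abs_le hψ hε
  let L : s → StrongDual ℝ X →ₗ[ℝ] ℝ := fun x =>
    (NormedSpace.inclusionInDoubleDual ℝ X (x : X)).toLinearMap
  let p : Submodule ℝ (StrongDual ℝ X) := ⨅ i, LinearMap.ker (L i)
  have hp : ∀ f ∈ p, ∀ x ∈ s, f x = 0 := fun f hf x hx =>
    (Submodule.mem_iInf _).1 hf ⟨x, hx⟩
  -- Extend `ψ` from the annihilator `p` of `s` to `g` of norm at most `ε`. Then `ψ - g` vanishes on
  -- a common kernel of finitely many evaluations, so it is a combination of them: evaluation at a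
  -- point.
  obtain ⟨g, hg, hgn⟩ := exists_extension_norm_eq p
    ((ψ ∘ₗ p.subtype).mkContinuous ε fun f => hs f (hp f f.2))
  have hgε : ‖g‖ ≤ ε := hgn ▸ LinearMap.mkContinuous_norm_le _ hε.le _
  have hker : p ≤ LinearMap.ker (ψ - g.toLinearMap) := fun f hf => by
    have := hg ⟨f, hf⟩
    change ψ f - g f = 0
    rw [this]
    exact sub_self (ψ f)
  obtain ⟨c, hc⟩ := (Submodule.mem_span_range_iff_exists_fun ℝ).1
    (mem_span_of_iInf_ker_le_ker hker)
  refine ⟨∑ i, c i • (i : X), fun f => ?_⟩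
  have hf := LinearMap.congr_fun hc f
  have hfx : f (∑ i, c i • (i : X)) = ψ f - g f := by
    refine Eq.trans ?_ hf
    simp [L]
  rw [hfx, sub_sub_cancel]
  exact (g.le_opNorm f).trans (mul_le_mul_of_nonneg_right hgε (norm_nonneg _))

/-- On the dual of a Banach space, a linear functional that is weak* continuous on the dual ball is
the evaluation at a point. -/
theorem exists_eq_apply_of_continuousOn_dualBall [CompleteSpace X] {ψ : StrongDual ℝ X →ₗ[ℝ] ℝ}
    (hψ : ContinuousOn (fun f : WeakDual ℝ X => ψ (WeakDual.toStrongDual f)) (dualBall ℝ X)) :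
    ∃ x : X, ∀ f : StrongDual ℝ X, ψ f = f x := by
  obtain ⟨x₁, hx₁⟩ := exists_forall_abs_sub_le hψ one_pos
  -- Comparison with the evaluation at `x₁`, with error `1`, shows that `ψ` is bounded.
  let Ψ : StrongDual ℝ (StrongDual ℝ X) := ψ.mkContinuous (‖x₁‖ + 1) fun f => by
    have h1 := hx₁ f
    have h2 := f.le_opNorm x₁
    have h3 := abs_sub_abs_le_abs_sub (ψ f) (f x₁)
    rw [Real.norm_eq_abs] at h2 ⊢
    linarith
  -- Completeness of `X` enters here: its image in the bidual is closed, so limits of evaluations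
  -- are evaluations.
  have hcl : IsClosed (range (NormedSpace.inclusionInDoubleDualLi ℝ (E := X))) := by
    have h := (NormedSpace.inclusionInDoubleDualLi ℝ (E := X)).isometry
    exact h.isUniformInducing.isComplete_range.isClosed
  have hmem : Ψ ∈ range (NormedSpace.inclusionInDoubleDualLi ℝ (E := X)) := by
    rw [← hcl.closure_eq]
    refine (Metric.mem_closure_iff (α := StrongDual ℝ (StrongDual ℝ X))).2 fun ε hε => ?_
    obtain ⟨x, hx⟩ := exists_forall_abs_sub_le hψ (half_pos hε)
    refine ⟨_, ⟨x, rfl⟩, lt_of_le_of_lt ?_ (half_lt_self hε)⟩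
    exact (dist_eq_norm (E := StrongDual ℝ (StrongDual ℝ X)) _ _).trans_le
      (ContinuousLinearMap.opNorm_le_bound _ (half_pos hε).le hx)
  obtain ⟨x, hx⟩ := hmem
  exact ⟨x, fun f => (congrArg (fun Φ : StrongDual ℝ (StrongDual ℝ X) => Φ f) hx).symm⟩

end Evaluation

/-! ### Linear extension from the unit ball -/

/-- A map on the unit ball that preserves convex combinations and the origin extends to a linear
map. -/
theorem exists_linearMap_eqOn_closedBall {E V : Type*} [NormedAddCommGroup E] [NormedSpace ℝ E]
    [AddCommGroup V] [Module ℝ V] {h : E → V} (h0 : h 0 = 0)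
    (hh : ∀ x y : E, ‖x‖ ≤ 1 → ‖y‖ ≤ 1 → ∀ a b : ℝ, 0 ≤ a → 0 ≤ b → a + b = 1 →
      h (a • x + b • y) = a • h x + b • h y) :
    ∃ T : E →ₗ[ℝ] V, ∀ x, ‖x‖ ≤ 1 → T x = h x := by
  have hsmul : ∀ x : E, ‖x‖ ≤ 1 → ∀ t : ℝ, 0 ≤ t → t ≤ 1 → h (t • x) = t • h x := by
    intro x hx t ht ht1
    simpa [h0] using hh x 0 hx (by simp) t (1 - t) ht (by linarith) (by ring)
  have hnorm : ∀ (x : E) (r : ℝ), ‖x‖ ≤ r → 0 < r → ‖r⁻¹ • x‖ ≤ 1 := by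
    intro x r hr hpos
    rw [norm_smul, norm_inv, Real.norm_of_nonneg hpos.le, inv_mul_le_iff₀ hpos]
    simpa using hr
  -- the value of the extension may be computed with any radius
  have key : ∀ (x : E) (r s : ℝ), ‖x‖ ≤ r → 0 < r → r ≤ s → s • h (s⁻¹ • x) = r • h (r⁻¹ • x) := by
    intro x r s hr hpos hrs
    have hs : 0 < s := hpos.trans_le hrs
    have := hsmul (r⁻¹ • x) (hnorm x r hr hpos) (r / s) (by positivity) ((div_le_one hs).2 hrs)
    rw [smul_smul] at this
    rw [show s⁻¹ = r / s * r⁻¹ by field_simp, this, smul_smul]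
    congr 1
    field_simp
  -- The `+ 1` keeps the radius positive at `x = 0`.
  let T : E → V := fun x => (‖x‖ + 1) • h ((‖x‖ + 1)⁻¹ • x)
  have hT : ∀ (x : E) (r : ℝ), ‖x‖ ≤ r → 0 < r → T x = r • h (r⁻¹ • x) := by
    intro x r hr hpos
    have h1 : 0 < ‖x‖ + 1 := by positivity
    rcases le_total r (‖x‖ + 1) with hle | hle
    · exact key x r _ hr hpos hle
    · exact (key x _ r (by linarith) h1 hle).symm
  have hadd : ∀ x y, T (x + y) = T x + T y := by
    intro x y
    let r : ℝ := ‖x‖ + ‖y‖ + 1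
    have hr : 0 < r := by positivity
    have hx : ‖x‖ ≤ r := by have := norm_nonneg y; simp only [r]; linarith
    have hy : ‖y‖ ≤ r := by have := norm_nonneg x; simp only [r]; linarith
    -- With radius `2 * r`, the rescaled sum is the midpoint of `r⁻¹ • x` and `r⁻¹ • y`.
    have hxy : ‖x + y‖ ≤ 2 * r := (norm_add_le x y).trans (by linarith)
    rw [hT x r hx hr, hT y r hy hr, hT (x + y) (2 * r) hxy (by linarith)]
    have := hh (r⁻¹ • x) (r⁻¹ • y) (hnorm x r hx hr) (hnorm y r hy hr) (1 / 2) (1 / 2)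
      (by norm_num) (by norm_num) (by norm_num)
    rw [smul_smul, smul_smul, ← smul_add] at this
    rw [show (2 * r)⁻¹ = 1 / 2 * r⁻¹ by field_simp, this, smul_add, smul_smul, smul_smul]
    congr 2 <;> ring
  have hpos_smul : ∀ (c : ℝ) (x : E), 0 < c → T (c • x) = c • T x := by
    intro c x hc
    have h1 : 0 < ‖x‖ + 1 := by positivity
    have hle : ‖c • x‖ ≤ c * (‖x‖ + 1) := by
      rw [norm_smul, Real.norm_of_nonneg hc.le]
      exact mul_le_mul_of_nonneg_left (by linarith) hc.le
    rw [hT (c • x) (c * (‖x‖ + 1)) hle (by positivity), smul_smul, mul_smul,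
      show (c * (‖x‖ + 1))⁻¹ * c = (‖x‖ + 1)⁻¹ by field_simp]
  have hT0 : T 0 = 0 := by simp [T, h0]
  have hneg : ∀ x, T (-x) = -T x := fun x => by
    have := hadd x (-x)
    rw [add_neg_cancel, hT0] at this
    exact (neg_eq_of_add_eq_zero_right this.symm).symm
  refine ⟨{ toFun := T, map_add' := hadd, map_smul' := fun c x => ?_ }, fun x hx => ?_⟩
  · rcases lt_trichotomy c 0 with hc | rfl | hc
    · have := hpos_smul (-c) x (by linarith)
      rw [neg_smul, hneg, neg_smul] at this
      exact neg_injective this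
    · simp [hT0]
    · exact hpos_smul c x hc
  · change T x = h x
    rw [hT x 1 hx one_pos]
    simp

/-! ### The two implications -/

/-- If the dual ball of a real Banach space embeds affinely in a space with its weak topology, then
the space is weakly compactly generated. -/
theorem AffinelyHomeomorphic.isWCG {𝕂 X Y : Type*} [NormedAddCommGroup X] [NormedSpace ℝ X]
    [CompleteSpace X] [RCLike 𝕂] [NormedAddCommGroup Y] [NormedSpace 𝕂 Y] [NormedSpace ℝ Y]
    [IsScalarTower ℝ 𝕂 Y] {K : Set (WeakSpace 𝕂 Y)}
    (h : AffinelyHomeomorphic (dualBall ℝ X) K) : IsWCG ℝ X := by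
  classical
  obtain ⟨e, he⟩ := h
  have mem_iff : ∀ f : StrongDual ℝ X, StrongDual.toWeakDual f ∈ dualBall ℝ X ↔ ‖f‖ ≤ 1 :=
    fun f => mem_dualBall
  let ι : dualBall ℝ X → Y := fun f => (toWeakSpace 𝕂 Y).symm (e f : WeakSpace 𝕂 Y)
  let o : dualBall ℝ X := ⟨StrongDual.toWeakDual 0, (mem_iff 0).2 (by simp)⟩
  -- Subtracting `ι o` sends the origin to the origin; the value off the ball is immaterial.
  let k : StrongDual ℝ X → Y := fun f =>
    if hf : ‖f‖ ≤ 1 then ι ⟨StrongDual.toWeakDual f, (mem_iff f).2 hf⟩ - ι o else 0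
  have hk : ∀ (f : StrongDual ℝ X) (hf : ‖f‖ ≤ 1),
      k f = ι ⟨StrongDual.toWeakDual f, (mem_iff f).2 hf⟩ - ι o := fun f hf => dif_pos hf
  obtain ⟨T, hT⟩ := exists_linearMap_eqOn_closedBall (h := k)
    (by rw [hk 0 (by simp)]; exact sub_self (ι o))
    (by
      intro f g hf hg a b ha hb hab
      have hfg : ‖a • f + b • g‖ ≤ 1 := by
        refine (norm_add_le _ _).trans ?_
        rw [norm_smul, norm_smul, Real.norm_of_nonneg ha, Real.norm_of_nonneg hb]
        nlinarith
      have hι : ι ⟨StrongDual.toWeakDual (a • f + b • g), (mem_iff _).2 hfg⟩ =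
          a • ι ⟨StrongDual.toWeakDual f, (mem_iff f).2 hf⟩ +
            b • ι ⟨StrongDual.toWeakDual g, (mem_iff g).2 hg⟩ :=
        he _ _ _ a b ha hb hab rfl
      rw [hk _ hfg, hk f hf, hk g hg, hι, smul_sub, smul_sub]
      have : ι o = a • ι o + b • ι o := by rw [← add_smul, hab, one_smul]
      nth_rewrite 1 [this]
      abel)
  have hTinj : ∀ f, T f = 0 → f = 0 := by
    intro f hf
    by_contra hne
    have hpos : 0 < ‖f‖ := norm_pos_iff.2 hne
    have hn : ‖‖f‖⁻¹ • f‖ ≤ 1 := by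
      rw [norm_smul, norm_inv, norm_norm, inv_mul_cancel₀ hpos.ne']
    have h1 : k (‖f‖⁻¹ • f) = 0 := by rw [← hT _ hn, map_smul, hf, smul_zero]
    rw [hk _ hn, sub_eq_zero] at h1
    have h2 := e.injective (Subtype.ext ((toWeakSpace 𝕂 Y).symm.injective h1))
    have h3 : ‖f‖⁻¹ • f = 0 := StrongDual.toWeakDual.injective (congrArg Subtype.val h2)
    exact hne ((smul_eq_zero.1 h3).resolve_left (inv_ne_zero hpos.ne'))
  have hcont : ∀ g : StrongDual ℝ Y, ContinuousOn
      (fun f : WeakDual ℝ X => (g.toLinearMap ∘ₗ T) (WeakDual.toStrongDual f))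
      (dualBall ℝ X) := by
    intro g
    rw [continuousOn_iff_continuous_domRestrict]
    have h1 : Continuous fun f : dualBall ℝ X => g (ι f) - g (ι o) :=
      ((WeakSpace.continuous_apply_real (𝕜 := 𝕂) g).comp
        (continuous_subtype_val.comp e.continuous)).sub continuous_const
    convert h1 using 2 with f
    have hf : ‖WeakDual.toStrongDual (f : WeakDual ℝ X)‖ ≤ 1 := mem_dualBall.1 f.2
    change g (T (WeakDual.toStrongDual (f : WeakDual ℝ X))) = _
    rw [hT _ hf, hk _ hf, map_sub]
    rfl
  -- `S` is the adjoint of `T`, with values in `X` rather than only in its bidual.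
  choose S hS using fun g : StrongDual ℝ Y => exists_eq_apply_of_continuousOn_dualBall (hcont g)
  have hS : ∀ (g : StrongDual ℝ Y) (f : StrongDual ℝ X), g (T f) = f (S g) := hS
  refine ⟨S '' Metric.closedBall 0 1, ?_, ?_⟩
  · have hSc : Continuous fun g : WeakDual ℝ Y => toWeakSpace ℝ X (S (WeakDual.toStrongDual g)) := by
      refine WeakSpace.continuous_of_forall_re fun f => ?_
      change Continuous fun g : WeakDual ℝ Y => f (S (WeakDual.toStrongDual g))
      simp only [← hS]
      exact WeakDual.eval_continuous (T f)
    have := (isCompact_dualBall ℝ Y).image hSc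
    convert this using 1
    rw [image_image]
    rfl
  · rw [Submodule.topologicalClosure_span_eq_top_iff]
    intro f hf
    apply hTinj
    by_contra hne
    -- A norming functional `g` of `T f` gives `‖T f‖ = g (T f) = f (S g) = 0`.
    obtain ⟨g, hg, hgT⟩ := exists_dual_vector'' ℝ (T f)
    rw [hS, hf _ ⟨g, by simpa using hg, rfl⟩] at hgT
    exact hne (norm_eq_zero.1 (by simpa using hgT.symm))

/-- The dual ball of a weakly compactly generated real Banach space is affinely homeomorphic to a
convex weakly compact set of continuous functions on a compact space. -/
theorem IsWCG.exists_affinelyHomeomorphic (𝕂 : Type w) {X : Type u} [RCLike 𝕂]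
    [NormedAddCommGroup X] [NormedSpace ℝ X] (h : IsWCG ℝ X) :
    ∃ (Q : Type (max u v)) (_ : TopologicalSpace Q) (_ : CompactSpace Q)
      (K : Set (WeakSpace 𝕂 C(Q, 𝕂))),
      Convex ℝ K ∧ IsCompact K ∧ AffinelyHomeomorphic (dualBall ℝ X) K := by
  obtain ⟨K, hK, hspan⟩ := h
  obtain ⟨C, hC⟩ := exists_norm_le_of_isCompact_toWeakSpace hK
  have : CompactSpace (toWeakSpace ℝ X '' K) := isCompact_iff_compactSpace.1 hK
  -- `Q` is `K` with its weak topology; the lift only adjusts the universe.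
  let Q := ULift.{v} (toWeakSpace ℝ X '' K)
  let pt : Q → X := fun q => (toWeakSpace ℝ X).symm (q.down : WeakSpace ℝ X)
  have hpt : ∀ q, pt q ∈ K := fun q => by
    obtain ⟨k, hk, hkq⟩ := q.down.2
    simpa only [pt, ← hkq, LinearEquiv.symm_apply_apply] using hk
  have hpt' : ∀ k ∈ K, ∃ q, pt q = k := fun k hk => ⟨⟨⟨_, k, hk, rfl⟩⟩, rfl⟩
  let R : WeakDual ℝ X → C(Q, ℝ) := fun f =>
    ⟨fun q => f (pt q), (WeakSpace.continuous_apply (𝕜 := ℝ) (WeakDual.toStrongDual f)).comp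
      (continuous_subtype_val.comp continuous_uliftDown)⟩
  let J : C(Q, ℝ) →L[ℝ] C(Q, 𝕂) := (RCLike.ofRealCLM (K := 𝕂)).compLeftContinuous ℝ Q
  let T : WeakDual ℝ X →ₗ[ℝ] WeakSpace 𝕂 C(Q, 𝕂) :=
    { toFun := fun f => toWeakSpace 𝕂 C(Q, 𝕂) (J (R f))
      map_add' := fun f g => J.map_add (R f) (R g)
      map_smul' := fun c f => J.map_smul c (R f) }
  have hTinj : Function.Injective T := by
    refine (injective_iff_map_eq_zero T).2 fun f hf => ?_
    refine (Submodule.topologicalClosure_span_eq_top_iff.1 hspan) (WeakDual.toStrongDual f)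
      fun k hk => ?_
    obtain ⟨q, rfl⟩ := hpt' k hk
    have : ((f (pt q) : ℝ) : 𝕂) = 0 :=
      DFunLike.congr_fun ((toWeakSpace 𝕂 C(Q, 𝕂)).map_eq_zero_iff.1 hf) q
    exact_mod_cast this
  have hTc : ContinuousOn T (dualBall ℝ X) := by
    rw [continuousOn_iff_continuous_domRestrict]
    have : CompactSpace (dualBall ℝ X) := isCompact_iff_compactSpace.1 (isCompact_dualBall ℝ X)
    refine WeakSpace.continuous_of_forall_re fun φ => ?_
    -- Composing with `J` and the real part turns `φ` into a real functional on `C(Q, ℝ)`, to which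
    -- Grothendieck's theorem applies.
    refine ContinuousMap.continuous_functional_of_separately_continuous
      (RCLike.reCLM ∘L φ.restrictScalars ℝ ∘L J) (F := fun f : dualBall ℝ X => R f)
      (fun q => (WeakDual.eval_continuous (pt q)).comp continuous_subtype_val) (C := C)
      fun f q => ?_
    have h1 := (WeakDual.toStrongDual (f : WeakDual ℝ X)).le_opNorm (pt q)
    have h2 := mem_dualBall.1 f.2
    have h3 := hC _ (hpt q)
    exact h1.trans (by nlinarith [norm_nonneg (pt q)])
  refine ⟨Q, inferInstance, inferInstance, T '' dualBall ℝ X, ?_,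
    (isCompact_dualBall ℝ X).image_of_continuousOn hTc,
    .image_of_isCompact T (isCompact_dualBall ℝ X) hTc hTinj.injOn⟩
  refine Convex.linear_image ?_ T
  intro f hf g hg a b ha hb hab
  rw [mem_dualBall] at *
  have hfg : ‖a • WeakDual.toStrongDual f + b • WeakDual.toStrongDual g‖ ≤ 1 := by
    refine (norm_add_le _ _).trans ?_
    rw [norm_smul, norm_smul, Real.norm_of_nonneg ha, Real.norm_of_nonneg hb]
    nlinarith
  exact hfg

theorem mainTheorem8 {𝕜 𝕂 : Type w} [RCLike 𝕜] [RCLike 𝕂]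
    {X : Type u} [NormedAddCommGroup X] [NormedSpace 𝕜 X] [CompleteSpace X] :
    (∃ (Y : Type (max u v w)) (_ : NormedAddCommGroup Y) (_ : NormedSpace 𝕂 Y)
        (_ : NormedSpace ℝ Y) (_ : IsScalarTower ℝ 𝕂 Y) (_ : CompleteSpace Y)
        (K : Set (WeakSpace 𝕂 Y)),
        Convex ℝ K ∧ IsCompact K ∧ AffinelyHomeomorphic (dualBall 𝕜 X) K) ↔
      IsWCG 𝕜 X := by
  let _ : NormedSpace ℝ X := NormedSpace.restrictScalars ℝ 𝕜 X
  have : IsScalarTower ℝ 𝕜 X := RestrictScalars.isScalarTower ℝ 𝕜 X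
  rw [isWCG_iff_isWCG_real (𝕜 := 𝕜)]
  constructor
  · rintro ⟨Y, _, _, _, _, _, K, -, -, h⟩
    exact ((affinelyHomeomorphic_dualBall_real 𝕜 X).trans h).isWCG
  · intro h
    obtain ⟨Q, _, _, K, hconv, hcomp, hK⟩ := h.exists_affinelyHomeomorphic.{u, v, w} 𝕂
    exact ⟨C(Q, 𝕂), inferInstance, inferInstance, inferInstance, inferInstance, inferInstance, K,
      hconv, hcomp, (dualBall_affinelyHomeomorphic_real 𝕜 X).trans hK⟩
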